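/- Let $F:[0,\infty)\to[0,\infty)$ be a $C^2$ function with $F(0)=0$ and $F'>0$ on $(0,\infty)$, and let $u:(M^m,g)\to(N^n,h)$ be a smooth map between smooth Riemannian manifolds (finite-dimensional, without boundary). For $x\in M$ and an orthonormal basis $e_1,\dots,e_m$ of $T_xM$ put, for $X,Y\in T_xM$, $$\|u^*h\|^2=\sum_{i,j=1}^m\langle du(e_i),du(e_j)\rangle_h^2,\qquad \sigma_u(X)=\sum_{j=1}^m\langle du(X),du(e_j)\rangle_h\,du(e_j),\qquad \sigma_{F,u}(X)=F'\Big(\frac{\|u^*h\|^2}{4}\Big)\sigma_u(X),$$ and define the stress-energy tensor $$S_{\Phi_F,u}(X,Y)=F\Big(\frac{\|u^*h\|^2}{4}\Big)\langle X,Y\rangle_g-F'\Big(\frac{\|u^*h\|^2}{4}\Big)\langle\sigma_u(X),du(Y)\rangle_h .$$ Let $\nabla$ be the Levi-Civita connection of $M$ and $\tilde\nabla$ the connection on $u^{-1}TN$ induced by the Levi-Civita connection of $N$; write $(\operatorname{div}S)(X)=\sum_k(\nabla_{e_k}S)(e_k,X)$ and $\operatorname{div}_g\sigma_{F,u}=\sum_k(\nabla_{e_k}\sigma_{F,u})(e_k)$,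 where $(\nabla_v\sigma_{F,u})(Y)=\tilde\nabla_v(\sigma_{F,u}(Y))-\sigma_{F,u}(\nabla_vY)$. Then for all $x\in M$ and all $X\in T_xM$, $$(\operatorname{div}S_{\Phi_F,u})(X)=-\langle\operatorname{div}_g\sigma_{F,u},du(X)\rangle_h .$$ Consequently, if $u$ is stationary for $\Phi_F$, i.e. $\operatorname{div}_g\sigma_{F,u}=0$ on $M$, then $u$ satisfies the $\Phi_F$-conservation law, i.e. $\operatorname{div}S_{\Phi_F,u}=0$ on $M$. -/

import Mathlib

open Bundle
open scoped Manifold ContDiff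

noncomputable section

namespace PhiEnergy

/-! ### Levi-Civita connection of a Riemannian manifold -/

section LeviCivita

variable
  {E : Type*} [NormedAddCommGroup E] [NormedSpace ℝ E] [FiniteDimensional ℝ E]
  {H : Type*} [TopologicalSpace H] (I : ModelWithCorners ℝ E H)
  {M : Type*} [TopologicalSpace M] [ChartedSpace H M] [IsManifold I ∞ M]

instance instFiniteDimensionalTangentSpace (x : M) : FiniteDimensional ℝ (TangentSpace I x) :=
  inferInstanceAs (FiniteDimensional ℝ E)

/-- The vector field with value `v` at `x` and constant components in the preferred chart
at `x` (on the domain of that chart; it is zero elsewhere): if `v = ∑ vⁱ ∂ᵢ` at `x`, this is the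
field `∑ vⁱ ∂ᵢ`. -/
def coordField {x : M} (v : TangentSpace I x) : ∀ p : M, TangentSpace I p := fun p ↦
  (trivializationAt E (TangentSpace I : M → Type _) x).symmL ℝ p
    ((trivializationAt E (TangentSpace I : M → Type _) x).continuousLinearMapAt ℝ x v)

variable [RiemannianBundle (fun x : M ↦ TangentSpace I x)]

/-- An orthonormal basis `e₁, …, e_m` of the tangent space at `x`. -/
def onb (x : M) :
    OrthonormalBasis (Fin (Module.finrank ℝ (TangentSpace I x))) ℝ (TangentSpace I x) :=
  stdOrthonormalBasis ℝ (TangentSpace I x)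

/-- The Christoffel symbol of the first kind at `x`, in the preferred chart at `x`:
`Γ(v, w; z) = ½ (∂_v g(w, z) + ∂_w g(v, z) - ∂_z g(v, w))`, where `g(w, z)` is the function
`p ↦ ∑ wʲ zᵏ g_{jk}(p)` near `x`. -/
def christoffelFirst (x : M) (v w z : TangentSpace I x) : ℝ :=
  (1 / 2 : ℝ) *
    (mvfderiv I (fun p : M ↦ inner ℝ (coordField I w p) (coordField I z p)) x v
      + mvfderiv I (fun p : M ↦ inner ℝ (coordField I v p) (coordField I z p)) x w
      - mvfderiv I (fun p : M ↦ inner ℝ (coordField I v p) (coordField I w p)) x z)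

/-- The Christoffel symbol (of the second kind) at `x`, in the preferred chart at `x`: the
tangent vector `Γ(v, w)` with `⟨Γ(v, w), z⟩ = Γ(v, w; z)` for all `z`, that is
`∑ Γᵏᵢⱼ vⁱ wʲ ∂ₖ`. -/
def christoffel (x : M) (v w : TangentSpace I x) : TangentSpace I x :=
  ∑ k, christoffelFirst I x v w (onb I x k) • onb I x k

end LeviCivita

section Maps

variable
  {E : Type*} [NormedAddCommGroup E] [NormedSpace ℝ E] [FiniteDimensional ℝ E]
  {H : Type*} [TopologicalSpace H] (I : ModelWithCorners ℝ E H)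
  {M : Type*} [TopologicalSpace M] [ChartedSpace H M] [IsManifold I ∞ M]
  {E' : Type*} [NormedAddCommGroup E'] [NormedSpace ℝ E'] [FiniteDimensional ℝ E']
  {H' : Type*} [TopologicalSpace H'] (I' : ModelWithCorners ℝ E' H')
  {N : Type*} [TopologicalSpace N] [ChartedSpace H' N] [IsManifold I' ∞ N]

/-- The connection `∇̃` on `u⁻¹TN` induced by the Levi-Civita connection of `N`, for a map
`u : M → N`. If the section `W` of `u⁻¹TN` has the components `Wᵏ` in the preferred chart of `N`
at `u x`, then
`∇̃_v W = ∑ₖ (v(Wᵏ) + ∑ᵢⱼ Γᵏᵢⱼ(u x) du(v)ⁱ Wʲ(x)) ∂ₖ`.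
The inverse trivialization `symmL` turns the derivatives of the components back into a tangent
vector at `u x`. -/
def covDerivAlong [RiemannianBundle (fun y : N ↦ TangentSpace I' y)]
    (u : M → N) (W : ∀ p : M, TangentSpace I' (u p)) (x : M) (v : TangentSpace I x) :
    TangentSpace I' (u x) :=
  (trivializationAt E' (TangentSpace I' : N → Type _) (u x)).symmL ℝ (u x)
      (mvfderiv I
        (fun p : M ↦ (trivializationAt E' (TangentSpace I' : N → Type _) (u x)).continuousLinearMapAt
          ℝ (u p) (W p)) x v)
    + christoffel I' (u x) (mfderiv I I' u x v) (W x)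

variable [RiemannianBundle (fun x : M ↦ TangentSpace I x)]

/-- The Levi-Civita connection `∇_v X` of `M`; it is the induced connection for the identity
map. -/
def leviCivita (X : ∀ p : M, TangentSpace I p) (x : M) (v : TangentSpace I x) :
    TangentSpace I x :=
  covDerivAlong I I (fun p : M ↦ p) X x v

/-- The divergence of a `2`-tensor field `T` on `M`:
`(div T)(X) = ∑ₖ (∇_{eₖ} T)(eₖ, X)` with
`(∇_v T)(Y, Z) = v(T(Y, Z)) - T(∇_v Y, Z) - T(Y, ∇_v Z)`.
As `∇ T` is a tensor, any local extensions `Y`, `Z` of the given vectors may be used. -/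
def divTensor (T : ∀ p : M, TangentSpace I p → TangentSpace I p → ℝ) (x : M)
    (X : TangentSpace I x) : ℝ :=
  ∑ k,
    (mvfderiv I (fun p : M ↦ T p (coordField I (onb I x k) p) (coordField I X p)) x (onb I x k)
      - T x (leviCivita I (coordField I (onb I x k)) x (onb I x k)) X
      - T x (onb I x k) (leviCivita I (coordField I X) x (onb I x k)))

variable [RiemannianBundle (fun y : N ↦ TangentSpace I' y)] (u : M → N)

/-- The divergence of a `u⁻¹TN`-valued `1`-form `A` on `M`:
`div A = ∑ₖ (∇_{eₖ} A)(eₖ)` with `(∇_v A)(Y) = ∇̃_v (A(Y)) - A(∇_v Y)`.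
As `∇ A` is a tensor, any local extension `Y` of the given vector may be used. -/
def divForm (A : ∀ p : M, TangentSpace I p → TangentSpace I' (u p)) (x : M) :
    TangentSpace I' (u x) :=
  ∑ k,
    (covDerivAlong I I' u (fun p : M ↦ A p (coordField I (onb I x k) p)) x (onb I x k)
      - A x (leviCivita I (coordField I (onb I x k)) x (onb I x k)))

/-- The pullback metric `(u*h)(X, Y) = ⟨du(X), du(Y)⟩`. -/
def pullbackMetric (x : M) (X Y : TangentSpace I x) : ℝ :=
  inner ℝ (mfderiv I I' u x X) (mfderiv I I' u x Y)

/-- `‖u*h‖² = ∑ᵢⱼ ⟨du(eᵢ), du(eⱼ)⟩²`. -/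
def pullbackNormSq (x : M) : ℝ :=
  ∑ i, ∑ j, pullbackMetric I I' u x (onb I x i) (onb I x j) ^ 2

/-- `σ_u(X) = ∑ⱼ ⟨du(X), du(eⱼ)⟩ du(eⱼ)`. -/
def sigma (x : M) (X : TangentSpace I x) : TangentSpace I' (u x) :=
  ∑ j, pullbackMetric I I' u x X (onb I x j) • mfderiv I I' u x (onb I x j)

/-- The derivative `F'` of a function on `[0, ∞)`, one-sided at `0`. -/
def derivF (F : ℝ → ℝ) (t : ℝ) : ℝ := derivWithin F (Set.Ici 0) t

/-- `σ_{F,u}(X) = F'(‖u*h‖² / 4) σ_u(X)`. -/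
def sigmaF (F : ℝ → ℝ) (x : M) (X : TangentSpace I x) : TangentSpace I' (u x) :=
  derivF F (pullbackNormSq I I' u x / 4) • sigma I I' u x X

/-- The stress-energy tensor
`S(X, Y) = F(‖u*h‖² / 4) ⟨X, Y⟩ - F'(‖u*h‖² / 4) ⟨σ_u(X), du(Y)⟩`. -/
def stressEnergy (F : ℝ → ℝ) (x : M) (X Y : TangentSpace I x) : ℝ :=
  F (pullbackNormSq I I' u x / 4) * inner ℝ X Y
    - derivF F (pullbackNormSq I I' u x / 4)
      * inner ℝ (sigma I I' u x X) (mfderiv I I' u x Y)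

/-- `u` is stationary for `Φ_F`: it solves the Euler-Lagrange equation `div_g σ_{F,u} = 0`. -/
def IsStationary (F : ℝ → ℝ) : Prop :=
  ∀ x : M, divForm I I' u (sigmaF I I' u F) x = 0

/-- `u` satisfies the `Φ_F`-conservation law: `div S_{Φ_F,u} = 0`. -/
def SatisfiesConservationLaw (F : ℝ → ℝ) : Prop :=
  ∀ (x : M) (X : TangentSpace I x), divTensor I (stressEnergy I I' u F) x X = 0

end Maps

/-- The standing assumptions on `F : [0, ∞) → [0, ∞)`: it is `C²`, `F(0) = 0`, and `F' > 0` on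
`(0, ∞)`. The values of `F` on `(-∞, 0)` play no role. -/
structure Admissible (F : ℝ → ℝ) : Prop where
  contDiffOn : ContDiffOn ℝ 2 F (Set.Ici 0)
  nonneg : ∀ t, 0 ≤ t → 0 ≤ F t
  zero : F 0 = 0
  deriv_pos : ∀ t, 0 < t → 0 < derivF F t

end PhiEnergy

end

/-!
The identity is a computation at a point `x` with the Levi-Civita connections. Let `e₁, …, e_m` be an
orthonormal basis at `x` and `f = F(‖u*h‖² / 4)`. Both connections are metric, so the product rule
gives

`(div S)(X) = df(X) - ⟨div σ_{F,u}, du(X)⟩ - ∑ₖ ⟨σ_{F,u}(eₖ), (∇du)(eₖ, X)⟩`,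

where `∇du` is the second fundamental form of `u` (`hessianForm`). It remains to see that the first
and the last term cancel. Let `P` be the endomorphism of the tangent space with
`⟨P v, w⟩ = (u*h)(v, w)`. Then `σ_u = du ∘ P` and `‖u*h‖² = tr (P ∘ P)`, and differentiating the
definition of `P` covariantly gives `d(‖u*h‖²)(X) = 4 ∑ₖ ⟨du(P eₖ), (∇du)(X, eₖ)⟩`
(`fderiv_trace_sq`). Hence `df(X) = ∑ₖ ⟨σ_{F,u}(eₖ), (∇du)(X, eₖ)⟩`, and `∇du` is symmetric because
second derivatives commute and both connections are torsion-free (`hessianForm_symm`).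

The computation is carried out for fields of bilinear forms on vector spaces
(`div_stressEnergy_euclidean`) and transported to the manifolds by the preferred charts at `x` and
`u x`. In these charts the trivializations of the tangent bundles at the base points are the identity,
and the differential of `u` is the derivative of its chart expression
(`continuousLinearMapAt_mfderiv_symmL`). The one delicate point is that `pullbackNormSq` and `sigma`
are written with an orthonormal basis chosen independently at each point; they are differentiable
because they can be expressed through `P`, that is, through the inverse of the metric
(`pullbackNormSq_eq_chartNormSq`, `continuousLinearMapAt_sigma`).
-/

namespace PhiEnergy

open scoped Topology

set_option synthInstance.maxHeartbeats 200000

/-! ### Christoffel symbols of a metric on a vector space -/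

section Euclidean

variable {E E' ι : Type*} [NormedAddCommGroup E] [NormedSpace ℝ E]
  [NormedAddCommGroup E'] [NormedSpace ℝ E'] [Fintype ι]

/-- The right-hand side `½ (D_v(w, z) + D_w(v, z) - D_z(v, w))` of Koszul's formula in coordinates,
where `D` is the derivative of the metric coefficients. -/
noncomputable def koszulForm (D : E →L[ℝ] E →L[ℝ] E →L[ℝ] ℝ) (v : E) : E →L[ℝ] E →L[ℝ] ℝ :=
  (1 / 2 : ℝ) • (D v + D.flip v - (D.flip v).flip)

theorem koszulForm_apply (D : E →L[ℝ] E →L[ℝ] E →L[ℝ] ℝ) (v w z : E) :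
    koszulForm D v w z = (1 / 2 : ℝ) * (D v w z + D w v z - D z v w) := by
  simp [koszulForm]

/-- `Γ` is the Christoffel symbol at `a` of the field `g` of bilinear forms: the constant fields `v`
and `w` satisfy `∇_v w = Γ(v, w)`. The form `g a` need not be nondegenerate, so `Γ` is
described by its products with all vectors. -/
def IsChristoffel (g : E → E →L[ℝ] E →L[ℝ] ℝ) (a : E) (Γ : E → E →ₗ[ℝ] E) : Prop :=
  ∀ v w z, g a (Γ v w) z = koszulForm (fderiv ℝ g a) v w z

theorem fderiv_bilin_apply {D : Type*} [NormedAddCommGroup D] [NormedSpace ℝ D]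
    {g : D → E →L[ℝ] E →L[ℝ] ℝ} {a : D} (hg : DifferentiableAt ℝ g a) (z : D) (v w : E) :
    fderiv ℝ (fun y ↦ g y v w) a z = fderiv ℝ g a z v w := by
  rw [((hg.hasFDerivAt.clm_apply (hasFDerivAt_const v a)).clm_apply
    (hasFDerivAt_const w a)).fderiv]
  simp

theorem fderiv_bilin_symm {g : E → E →L[ℝ] E →L[ℝ] ℝ} {a : E} (hg : DifferentiableAt ℝ g a)
    (hs : ∀ y v w, g y v w = g y w v) (z v w : E) :
    fderiv ℝ g a z v w = fderiv ℝ g a z w v := by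
  rw [← fderiv_bilin_apply hg, ← fderiv_bilin_apply hg]
  simp_rw [hs _ v w]

/-- The Levi-Civita connection is compatible with the metric. -/
theorem IsChristoffel.metric {g : E → E →L[ℝ] E →L[ℝ] ℝ} {a : E} {Γ : E → E →ₗ[ℝ] E}
    (hΓ : IsChristoffel g a Γ) (hg : DifferentiableAt ℝ g a)
    (hs : ∀ y v w, g y v w = g y w v) (v w z : E) :
    fderiv ℝ g a v w z = g a (Γ v w) z + g a w (Γ v z) := by
  rw [hs a w, hΓ, hΓ, koszulForm_apply, koszulForm_apply, fderiv_bilin_symm hg hs v z w]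
  ring

/-- The Levi-Civita connection is torsion-free. -/
theorem IsChristoffel.symm {g : E → E →L[ℝ] E →L[ℝ] ℝ} {a : E} {Γ : E → E →ₗ[ℝ] E}
    (hΓ : IsChristoffel g a Γ) (hg : DifferentiableAt ℝ g a)
    (hs : ∀ y v w, g y v w = g y w v) (hnd : ∀ v w, (∀ z, g a v z = g a w z) → v = w) (v w : E) :
    Γ v w = Γ w v := by
  refine hnd _ _ fun z ↦ ?_
  rw [hΓ, hΓ, koszulForm_apply, koszulForm_apply, fderiv_bilin_symm hg hs z w v]
  ring

/-- Metric compatibility of the connection induced along `u`, whose covariant derivative of `W` in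
the direction `v` is `∂_v W + Γ(∂_v u, W)`. -/
theorem fderiv_metric_along {h : E' → E' →L[ℝ] E' →L[ℝ] ℝ} {u : E → E'} {a : E}
    {Γ : E' → E' →ₗ[ℝ] E'} (hΓ : IsChristoffel h (u a) Γ) (hh : DifferentiableAt ℝ h (u a))
    (hs : ∀ y v w, h y v w = h y w v) (hu : DifferentiableAt ℝ u a) {W Z : E → E'}
    (hW : DifferentiableAt ℝ W a) (hZ : DifferentiableAt ℝ Z a) (v : E) :
    fderiv ℝ (fun y ↦ h (u y) (W y) (Z y)) a v
      = h (u a) (fderiv ℝ W a v + Γ (fderiv ℝ u a v) (W a)) (Z a)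
        + h (u a) (W a) (fderiv ℝ Z a v + Γ (fderiv ℝ u a v) (Z a)) := by
  have hc : HasFDerivAt (fun y ↦ h (u y)) (fderiv ℝ h (u a) ∘L fderiv ℝ u a) a :=
    HasFDerivAt.comp (g := h) a hh.hasFDerivAt hu.hasFDerivAt
  have := (hc.clm_apply hW.hasFDerivAt).clm_apply hZ.hasFDerivAt
  rw [this.fderiv]
  have := hΓ.metric hh hs (fderiv ℝ u a v) (W a) (Z a)
  simp [this]
  ring

/-- The trace of a bilinear form does not change when a self-adjoint operator is moved from one
argument to the other. The hypothesis `hb` says that the basis `b` is `g`-orthonormal. -/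
theorem sum_selfAdjoint (g : E →L[ℝ] E →L[ℝ] ℝ) (b : Module.Basis ι ℝ E)
    (hb : ∀ v i, b.repr v i = g v (b i)) (P : E →L[ℝ] E)
    (hP : ∀ v w, g (P v) w = g (P w) v) (β : E →ₗ[ℝ] E →ₗ[ℝ] ℝ) :
    ∑ i, β (P (b i)) (b i) = ∑ i, β (b i) (P (b i)) := by
  have expand : ∀ i, P (b i) = ∑ j, g (P (b i)) (b j) • b j := fun i ↦ by
    simpa [hb] using (b.sum_repr (P (b i))).symm
  have h1 : ∀ i, β (P (b i)) (b i) = ∑ j, g (P (b i)) (b j) * β (b j) (b i) := fun i ↦ by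
    conv_lhs => rw [expand i]
    simp
  have h2 : ∀ i, β (b i) (P (b i)) = ∑ j, g (P (b i)) (b j) * β (b i) (b j) := fun i ↦ by
    conv_lhs => rw [expand i]
    simp
  simp_rw [h1, h2]
  rw [Finset.sum_comm]
  refine Finset.sum_congr rfl fun i _ ↦ Finset.sum_congr rfl fun j _ ↦ ?_
  rw [hP]

theorem trace_eq_sum (g : E →L[ℝ] E →L[ℝ] ℝ) (b : Module.Basis ι ℝ E)
    (hb : ∀ v i, b.repr v i = g v (b i)) (T : E →L[ℝ] E) :
    LinearMap.trace ℝ E T = ∑ i, g (T (b i)) (b i) := by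
  classical
  rw [LinearMap.trace_eq_matrix_trace ℝ b, Matrix.trace]
  simp [LinearMap.toMatrix_apply, hb]

/-! ### The second fundamental form and the derivative of the energy density -/

/-- The second fundamental form `(∇du)(X, ·)` of `u` at `a`, in coordinates:
`Y ↦ ∂²u(X, Y) + Γ'(du X, du Y) - du (Γ(X, Y))`. -/
noncomputable def hessianForm (u : E → E') (a : E) (Γ : E → E →ₗ[ℝ] E)
    (Γ' : E' → E' →ₗ[ℝ] E') (X : E) : E →ₗ[ℝ] E' :=
  (fderiv ℝ (fderiv ℝ u) a X : E →ₗ[ℝ] E') + Γ' (fderiv ℝ u a X) ∘ₗ (fderiv ℝ u a : E →ₗ[ℝ] E')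
    - (fderiv ℝ u a : E →ₗ[ℝ] E') ∘ₗ Γ X

theorem hessianForm_apply (u : E → E') (a : E) (Γ : E → E →ₗ[ℝ] E) (Γ' : E' → E' →ₗ[ℝ] E')
    (X Y : E) : hessianForm u a Γ Γ' X Y = fderiv ℝ (fderiv ℝ u) a X Y
      + Γ' (fderiv ℝ u a X) (fderiv ℝ u a Y) - fderiv ℝ u a (Γ X Y) := by
  simp [hessianForm]

theorem hessianForm_symm {u : E → E'} {a : E} {Γ : E → E →ₗ[ℝ] E} {Γ' : E' → E' →ₗ[ℝ] E'}
    (hu : ContDiffAt ℝ 2 u a) (hΓ : ∀ v w, Γ v w = Γ w v) (hΓ' : ∀ v w, Γ' v w = Γ' w v)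
    (X Y : E) : hessianForm u a Γ Γ' X Y = hessianForm u a Γ Γ' Y X := by
  have := (hu.isSymmSndFDerivAt (by simp)).eq X Y
  rw [hessianForm_apply, hessianForm_apply, this, hΓ, hΓ' (fderiv ℝ u a X)]

/-- The derivative of `‖u*h‖² = tr (P ∘ P)`, where `P` is the endomorphism representing `u*h` with
respect to `g`: it is `4 ∑ᵢ ⟨du(P eᵢ), (∇du)(X, eᵢ)⟩`. The covariant derivative of
`g(P v, w) = h(du v, du w)` gives `g((∇_X P) v, w) = ⟨(∇du)(X, v), du w⟩ + ⟨du v, (∇du)(X, w)⟩`, and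
`∂_X P` differs from `∇_X P` by a commutator with `P`, which has no trace against `P`. -/
theorem fderiv_trace_sq [FiniteDimensional ℝ E] {g : E → E →L[ℝ] E →L[ℝ] ℝ}
    {h : E' → E' →L[ℝ] E' →L[ℝ] ℝ}
    {u : E → E'} {a : E} {Γ : E → E →ₗ[ℝ] E} {Γ' : E' → E' →ₗ[ℝ] E'}
    (hΓ : IsChristoffel g a Γ) (hg : DifferentiableAt ℝ g a) (hs : ∀ y v w, g y v w = g y w v)
    (hΓ' : IsChristoffel h (u a) Γ') (hh : DifferentiableAt ℝ h (u a))
    (hs' : ∀ y v w, h y v w = h y w v) (hu : ContDiffAt ℝ 2 u a)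
    {P : E → E →L[ℝ] E} (hPd : DifferentiableAt ℝ P a)
    (hP : ∀ᶠ y in 𝓝 a, ∀ v w, g y (P y v) w = h (u y) (fderiv ℝ u y v) (fderiv ℝ u y w))
    (b : Module.Basis ι ℝ E) (hb : ∀ v i, b.repr v i = g a v (b i)) (X : E) :
    DifferentiableAt ℝ (fun y ↦ LinearMap.trace ℝ E (P y ∘L P y : E →L[ℝ] E)) a ∧
    fderiv ℝ (fun y ↦ LinearMap.trace ℝ E (P y ∘L P y : E →L[ℝ] E)) a X
      = 4 * ∑ i, h (u a) (fderiv ℝ u a (P a (b i))) (hessianForm u a Γ Γ' X (b i)) := by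
  set A := fderiv ℝ u a with hA
  set B := hessianForm u a Γ Γ' X with hB
  set P' := fderiv ℝ P a X with hP'
  have hdu : DifferentiableAt ℝ (fderiv ℝ u) a :=
    (hu.fderiv_right (m := 1) (by norm_num)).differentiableAt (by norm_num)
  have hud : DifferentiableAt ℝ u a := hu.differentiableAt (by norm_num)
  have hPa := hP.self_of_nhds
  have hsa : ∀ v w, g a (P a v) w = g a (P a w) v := fun v w ↦ by
    rw [hPa, hPa, hs']
  -- The derivative of the relation defining `P`; the last two terms are the commutator of `P`
  -- with `Γ X`.
  have hP'g : ∀ v w, g a (P' v) w = h (u a) (B v) (A w) + h (u a) (A v) (B w)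
      + g a (P a (Γ X v)) w - g a (Γ X (P a v)) w := fun v w ↦ by
    have h1 : fderiv ℝ (fun y ↦ g y (P y v) w) a X
        = fderiv ℝ g a X (P a v) w + g a (P' v) w := by
      have := (hg.hasFDerivAt.clm_apply
        (hPd.hasFDerivAt.clm_apply (hasFDerivAt_const v a))).clm_apply (hasFDerivAt_const w a)
      rw [this.fderiv]
      simp [hP', add_comm]
    have h2 := fderiv_metric_along hΓ' hh hs' hud (hdu.clm_apply (differentiableAt_const v))
      (hdu.clm_apply (differentiableAt_const w)) X
    have h3 : ∀ v, fderiv ℝ (fun y ↦ fderiv ℝ u y v) a X = fderiv ℝ (fderiv ℝ u) a X v := fun v ↦ by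
      rw [(hdu.hasFDerivAt.clm_apply (hasFDerivAt_const v a)).fderiv]
      simp
    have h4 : (fun y ↦ g y (P y v) w) =ᶠ[𝓝 a]
        fun y ↦ h (u y) (fderiv ℝ u y v) (fderiv ℝ u y w) := by
      filter_upwards [hP] with y hy using hy v w
    have h5 : ∀ v, fderiv ℝ (fderiv ℝ u) a X v + Γ' (A X) (A v) = B v + A (Γ X v) := fun v ↦ by
      rw [hB, hessianForm_apply]; abel
    rw [← h4.fderiv_eq, h1, hΓ.metric hg hs] at h2
    simp only [h3, ← hA, h5, map_add, add_apply] at h2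
    rw [← hPa, ← hPa] at h2
    linarith
  -- The trace as a continuous functional, so that it commutes with the derivative.
  let tr : (E →L[ℝ] E) →L[ℝ] ℝ :=
    LinearMap.toContinuousLinearMap (LinearMap.trace ℝ E ∘ₗ ContinuousLinearMap.coeLM ℝ)
  have htr : HasFDerivAt (fun y ↦ LinearMap.trace ℝ E (P y ∘L P y : E →L[ℝ] E)) _ a :=
    tr.hasFDerivAt.comp a (hPd.hasFDerivAt.clm_comp hPd.hasFDerivAt)
  refine ⟨htr.differentiableAt, ?_⟩
  rw [htr.fderiv]
  have h6 : ∀ T : E →L[ℝ] E, tr T = ∑ i, g a (T (b i)) (b i) := trace_eq_sum (g a) b hb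
  have h7 : ∑ i, g a (P a (P' (b i))) (b i) = ∑ i, g a (P' (P a (b i))) (b i) :=
    (trace_eq_sum (g a) b hb (P a ∘L P')).symm.trans
      ((LinearMap.trace_mul_comm ℝ (P a : E →ₗ[ℝ] E) (P' : E →ₗ[ℝ] E)).trans
        (trace_eq_sum (g a) b hb (P' ∘L P a)))
  -- The two second-fundamental-form terms have equal traces, and the commutator terms cancel.
  have h8 : ∑ i, h (u a) (B (P a (b i))) (A (b i)) = ∑ i, h (u a) (B (b i)) (A (P a (b i))) :=
    sum_selfAdjoint (g a) b hb (P a) hsa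
      (((h (u a)).toLinearMap₁₂).compl₁₂ B (A : E →ₗ[ℝ] E'))
  have h9 : ∑ i, g a (Γ X (P a (P a (b i)))) (b i) = ∑ i, g a (Γ X (P a (b i))) (P a (b i)) :=
    sum_selfAdjoint (g a) b hb (P a) hsa
      (((g a).toLinearMap₁₂).compl₁₂ (Γ X ∘ₗ (P a : E →ₗ[ℝ] E)) LinearMap.id)
  have h10 : ∀ i, g a (P a (Γ X (P a (b i)))) (b i)
      = g a (Γ X (P a (b i))) (P a (b i)) := fun i ↦ by
    rw [hsa, hs]
  simp only [ContinuousLinearMap.comp_apply, map_add, add_apply, h6,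
    ContinuousLinearMap.compL_apply, ContinuousLinearMap.flip_apply]
  rw [Finset.sum_add_distrib, ← hP', h7]
  simp_rw [hP'g, h10, Finset.sum_sub_distrib, Finset.sum_add_distrib, h8, h9]
  simp_rw [hs' _ (B _)]
  ring

/-! ### The divergence identity in coordinates -/

/-- The divergence identity at one point, in coordinates. Here `f` and `φ` stand for
`F(‖u*h‖² / 4)` and `F'(‖u*h‖² / 4)`, related by `hf`, and `φ • du (P v)` is `σ_{F,u}(v)`.
The terms with derivatives of `g` cancel since `∇g = 0`; what remains besides the right-hand side is
`df(X) - ∑ₖ ⟨σ_{F,u}(eₖ), (∇du)(eₖ, X)⟩`, which vanishes by `fderiv_trace_sq` and the symmetry of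
`∇du`. -/
theorem div_stressEnergy_euclidean [FiniteDimensional ℝ E] {g : E → E →L[ℝ] E →L[ℝ] ℝ}
    {h : E' → E' →L[ℝ] E' →L[ℝ] ℝ}
    {u : E → E'} {a : E} {Γ : E → E →ₗ[ℝ] E} {Γ' : E' → E' →ₗ[ℝ] E'}
    (hΓ : IsChristoffel g a Γ) (hg : DifferentiableAt ℝ g a) (hs : ∀ y v w, g y v w = g y w v)
    (hΓs : ∀ v w, Γ v w = Γ w v)
    (hΓ' : IsChristoffel h (u a) Γ') (hh : DifferentiableAt ℝ h (u a))
    (hs' : ∀ y v w, h y v w = h y w v) (hΓs' : ∀ v w, Γ' v w = Γ' w v) (hu : ContDiffAt ℝ 2 u a)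
    {P : E → E →L[ℝ] E} (hPd : DifferentiableAt ℝ P a)
    (hP : ∀ᶠ y in 𝓝 a, ∀ v w, g y (P y v) w = h (u y) (fderiv ℝ u y v) (fderiv ℝ u y w))
    (b : Module.Basis ι ℝ E) (hb : ∀ v i, b.repr v i = g a v (b i))
    {f φ : E → ℝ} (hfd : DifferentiableAt ℝ f a) (hφ : DifferentiableAt ℝ φ a)
    (hf : ∀ X, fderiv ℝ f a X
      = φ a * (fderiv ℝ (fun y ↦ LinearMap.trace ℝ E (P y ∘L P y : E →L[ℝ] E)) a X / 4)) (X : E) :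
    ∑ k, (fderiv ℝ (fun y ↦ f y * g y (b k) X
            - h (u y) (φ y • fderiv ℝ u y (P y (b k))) (fderiv ℝ u y X)) a (b k)
        - (f a * g a (Γ (b k) (b k)) X
            - h (u a) (φ a • fderiv ℝ u a (P a (Γ (b k) (b k)))) (fderiv ℝ u a X))
        - (f a * g a (b k) (Γ (b k) X)
            - h (u a) (φ a • fderiv ℝ u a (P a (b k))) (fderiv ℝ u a (Γ (b k) X))))
      = - h (u a) (∑ k, (fderiv ℝ (fun y ↦ φ y • fderiv ℝ u y (P y (b k))) a (b k)
          + Γ' (fderiv ℝ u a (b k)) (φ a • fderiv ℝ u a (P a (b k)))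
          - φ a • fderiv ℝ u a (P a (Γ (b k) (b k))))) (fderiv ℝ u a X) := by
  have hdu : DifferentiableAt ℝ (fderiv ℝ u) a :=
    (hu.fderiv_right (m := 1) (by norm_num)).differentiableAt (by norm_num)
  have hud : DifferentiableAt ℝ u a := hu.differentiableAt (by norm_num)
  have hc : DifferentiableAt ℝ (fun y ↦ h (u y)) a :=
    DifferentiableAt.comp (g := h) a hh hud
  have hW : ∀ k, DifferentiableAt ℝ (fun y ↦ φ y • fderiv ℝ u y (P y (b k))) a := fun k ↦
    hφ.smul (hdu.clm_apply (hPd.clm_apply (differentiableAt_const _)))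
  have hZ : DifferentiableAt ℝ (fun y ↦ fderiv ℝ u y X) a :=
    hdu.clm_apply (differentiableAt_const _)
  have hgX : ∀ k, DifferentiableAt ℝ (fun y ↦ g y (b k) X) a := fun k ↦
    (hg.clm_apply (differentiableAt_const _)).clm_apply (differentiableAt_const _)
  have hZ' : ∀ v, fderiv ℝ (fun y ↦ fderiv ℝ u y X) a v
      = fderiv ℝ (fderiv ℝ u) a v X := fun v ↦ by
    rw [(hdu.hasFDerivAt.clm_apply (hasFDerivAt_const X a)).fderiv]
    simp
  have hgX' : ∀ k v, fderiv ℝ (fun y ↦ g y (b k) X) a v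
      = g a (Γ v (b k)) X + g a (b k) (Γ v X) := fun k v ↦ by
    rw [fderiv_bilin_apply hg, hΓ.metric hg hs]
  have term : ∀ k, fderiv ℝ (fun y ↦ f y * g y (b k) X
            - h (u y) (φ y • fderiv ℝ u y (P y (b k))) (fderiv ℝ u y X)) a (b k)
        - (f a * g a (Γ (b k) (b k)) X
            - h (u a) (φ a • fderiv ℝ u a (P a (Γ (b k) (b k)))) (fderiv ℝ u a X))
        - (f a * g a (b k) (Γ (b k) X)
            - h (u a) (φ a • fderiv ℝ u a (P a (b k))) (fderiv ℝ u a (Γ (b k) X)))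
      = fderiv ℝ f a (b k) * g a (b k) X
        - φ a * h (u a) (fderiv ℝ u a (P a (b k))) (hessianForm u a Γ Γ' X (b k))
        - h (u a) (fderiv ℝ (fun y ↦ φ y • fderiv ℝ u y (P y (b k))) a (b k)
          + Γ' (fderiv ℝ u a (b k)) (φ a • fderiv ℝ u a (P a (b k)))
          - φ a • fderiv ℝ u a (P a (Γ (b k) (b k)))) (fderiv ℝ u a X) := fun k ↦ by
    have h1 := fderiv_metric_along hΓ' hh hs' hud (hW k) hZ (b k)
    have h2 : fderiv ℝ (fun y ↦ f y * g y (b k) X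
            - h (u y) (φ y • fderiv ℝ u y (P y (b k))) (fderiv ℝ u y X)) a (b k)
        = f a * (g a (Γ (b k) (b k)) X + g a (b k) (Γ (b k) X)) + fderiv ℝ f a (b k) * g a (b k) X
          - fderiv ℝ (fun y ↦ h (u y) (φ y • fderiv ℝ u y (P y (b k))) (fderiv ℝ u y X)) a
            (b k) := by
      rw [fderiv_fun_sub (hfd.fun_mul (hgX k)) ((hc.clm_apply (hW k)).clm_apply hZ),
        fderiv_fun_mul hfd (hgX k)]
      simp only [sub_apply, add_apply, smul_apply, smul_eq_mul, hgX']
      ring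
    have h3 : fderiv ℝ (fderiv ℝ u) a (b k) X + Γ' (fderiv ℝ u a (b k)) (fderiv ℝ u a X)
        = hessianForm u a Γ Γ' X (b k) + fderiv ℝ u a (Γ (b k) X) := by
      rw [hessianForm_symm hu hΓs hΓs', hessianForm_apply]
      abel
    rw [h2, h1, hZ', h3]
    simp only [map_add, map_sub, map_smul, add_apply, sub_apply, smul_apply, smul_eq_mul]
    ring
  rw [Finset.sum_congr rfl fun k _ ↦ term k, Finset.sum_sub_distrib, Finset.sum_sub_distrib,
    ← Finset.mul_sum]
  have hdf : ∑ k, fderiv ℝ f a (b k) * g a (b k) X = fderiv ℝ f a X := by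
    conv_rhs => rw [← b.sum_repr X, map_sum]
    refine Finset.sum_congr rfl fun k _ ↦ ?_
    rw [map_smul, hb, hs, smul_eq_mul, mul_comm]
  rw [hdf, hf, (fderiv_trace_sq hΓ hg hs hΓ' hh hs' hu hPd hP b hb X).2, map_sum, sum_apply]
  ring

end Euclidean

/-! ### Derivatives and the metric in a chart -/

theorem differentiableAt_clm_of_apply {D E G : Type*} [NormedAddCommGroup D] [NormedSpace ℝ D]
    [NormedAddCommGroup E] [NormedSpace ℝ E] [FiniteDimensional ℝ E]
    [NormedAddCommGroup G] [NormedSpace ℝ G] {f : D → E →L[ℝ] G} {a : D}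
    (hf : ∀ v, DifferentiableAt ℝ (fun y ↦ f y v) a) : DifferentiableAt ℝ f a := by
  let b := Module.finBasis ℝ E
  have : f = fun y ↦ ∑ i, ContinuousLinearMap.smulRightL ℝ E G
      (LinearMap.toContinuousLinearMap (b.coord i)) (f y (b i)) := by
    funext y
    ext v
    conv_lhs => rw [← b.sum_repr v, map_sum]
    simp
  rw [this]
  exact DifferentiableAt.fun_sum fun i _ ↦
    (ContinuousLinearMap.differentiableAt _).comp a (hf (b i))

section Chart

variable
  {E : Type*} [NormedAddCommGroup E] [NormedSpace ℝ E] [FiniteDimensional ℝ E]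
  {H : Type*} [TopologicalSpace H] (I : ModelWithCorners ℝ E H) [I.Boundaryless]
  {M : Type*} [TopologicalSpace M] [ChartedSpace H M] [IsManifold I ∞ M]

omit [FiniteDimensional ℝ E] [IsManifold I ∞ M] in
/-- No differentiability is assumed: `f` is differentiable at `x` if and only if its chart
expression is, so both sides vanish otherwise. -/
theorem mvfderiv_eq_fderiv_chart {G : Type*} [NormedAddCommGroup G] [NormedSpace ℝ G]
    (f : M → G) (x : M) (v : TangentSpace I x) :
    mvfderiv I f x v
      = fderiv ℝ (fun y ↦ f ((extChartAt I x).symm y)) (extChartAt I x x) v := by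
  have hw : writtenInExtChartAt I 𝓘(ℝ, G) x f = fun y ↦ f ((extChartAt I x).symm y) := by
    ext y; rfl
  by_cases h : MDifferentiableAt I 𝓘(ℝ, G) f x
  · have : mfderiv I 𝓘(ℝ, G) f x v
      = fderiv ℝ (fun y ↦ f ((extChartAt I x).symm y)) (extChartAt I x x) v := by
      rw [h.mfderiv, hw, I.range_eq_univ, fderivWithin_univ]
      rfl
    exact this
  · have h0 : mfderiv I 𝓘(ℝ, G) f x = 0 := mfderiv_zero_of_not_mdifferentiableAt h
    have h1 : ¬ DifferentiableAt ℝ (fun y ↦ f ((extChartAt I x).symm y)) (extChartAt I x x) := by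
      intro hd
      apply h
      rw [mdifferentiableAt_iff, hw, I.range_eq_univ, differentiableWithinAt_univ]
      refine ⟨?_, hd⟩
      have hc : ContinuousAt (fun p ↦ f ((extChartAt I x).symm (extChartAt I x p))) x :=
        ContinuousAt.comp (f := extChartAt I x) (g := fun y ↦ f ((extChartAt I x).symm y))
          hd.continuousAt (continuousAt_extChartAt x)
      refine hc.congr ?_
      filter_upwards [extChartAt_source_mem_nhds (I := I) x] with p hp
      rw [(extChartAt I x).left_inv hp]
    rw [fderiv_zero_of_not_differentiableAt h1]
    have : mfderiv I 𝓘(ℝ, G) f x v = 0 := by rw [h0]; rfl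
    exact this

omit [FiniteDimensional ℝ E] [I.Boundaryless] in
/-- The preferred trivialization of the tangent bundle at `x` is the identity on the fibre at `x`,
both `TangentSpace I x` and the model fibre being `E`. -/
theorem continuousLinearMapAt_self (x : M) (v : TangentSpace I x) :
    (trivializationAt E (TangentSpace I : M → Type _) x).continuousLinearMapAt ℝ x v = v := by
  rw [TangentBundle.continuousLinearMapAt_trivializationAt_eq_core (mem_chart_source H x)]
  exact (tangentBundleCore I M).coordChange_self _ _ (mem_chart_source H x) v

omit [FiniteDimensional ℝ E] [I.Boundaryless] in
theorem symmL_self (x : M) (v : E) :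
    (trivializationAt E (TangentSpace I : M → Type _) x).symmL ℝ x v = v := by
  rw [TangentBundle.symmL_trivializationAt_eq_core (mem_chart_source H x)]
  exact (tangentBundleCore I M).coordChange_self _ _ (mem_chart_source H x) v

omit [FiniteDimensional ℝ E] [I.Boundaryless] in
theorem coordField_eq {x : M} (v : TangentSpace I x) (p : M) :
    coordField I v p = (trivializationAt E (TangentSpace I : M → Type _) x).symmL ℝ p v := by
  rw [coordField, continuousLinearMapAt_self]

variable [RiemannianBundle (fun x : M ↦ TangentSpace I x)]

/-- The metric in the preferred chart at `x`, as a field of bilinear forms on the model space: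
`chartMetric I x y v w` is the product of the fields with constant components `v` and `w` at the point
with coordinates `y`. It is meaningful only for `y` in the target of the chart. -/
noncomputable def chartMetric (x : M) (y : E) : E →L[ℝ] E →L[ℝ] ℝ :=
  (innerSL ℝ (E := TangentSpace I ((extChartAt I x).symm y))).bilinearComp
    ((trivializationAt E (TangentSpace I : M → Type _) x).symmL ℝ ((extChartAt I x).symm y))
    ((trivializationAt E (TangentSpace I : M → Type _) x).symmL ℝ ((extChartAt I x).symm y))

omit [FiniteDimensional ℝ E] [I.Boundaryless] in
theorem chartMetric_apply (x : M) (y v w : E) : chartMetric I x y v w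
    = inner ℝ ((trivializationAt E (TangentSpace I : M → Type _) x).symmL ℝ
          ((extChartAt I x).symm y) v)
        ((trivializationAt E (TangentSpace I : M → Type _) x).symmL ℝ
          ((extChartAt I x).symm y) w) := rfl

omit [FiniteDimensional ℝ E] [I.Boundaryless] in
theorem chartMetric_symm (x : M) (y v w : E) : chartMetric I x y v w = chartMetric I x y w v := by
  rw [chartMetric_apply, chartMetric_apply, real_inner_comm]

omit [FiniteDimensional ℝ E] [I.Boundaryless] in
theorem chartMetric_continuousLinearMapAt (x : M) {p : M} (hp : p ∈ (chartAt H x).source)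
    (V W : TangentSpace I p) :
    chartMetric I x (extChartAt I x p)
      ((trivializationAt E (TangentSpace I : M → Type _) x).continuousLinearMapAt ℝ p V)
      ((trivializationAt E (TangentSpace I : M → Type _) x).continuousLinearMapAt ℝ p W)
      = inner ℝ V W := by
  have aux : ∀ q, q = p → inner ℝ
      ((trivializationAt E (TangentSpace I : M → Type _) x).symmL ℝ q
        ((trivializationAt E (TangentSpace I : M → Type _) x).continuousLinearMapAt ℝ p V))
      ((trivializationAt E (TangentSpace I : M → Type _) x).symmL ℝ q
        ((trivializationAt E (TangentSpace I : M → Type _) x).continuousLinearMapAt ℝ p W))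
      = inner ℝ V W := by
    rintro q rfl
    have hq : q ∈ (trivializationAt E (TangentSpace I : M → Type _) x).baseSet := by simpa using hp
    rw [Trivialization.symmL_continuousLinearMapAt _ hq,
      Trivialization.symmL_continuousLinearMapAt _ hq]
  rw [chartMetric_apply]
  exact aux _ ((extChartAt I x).left_inv (by simpa using hp))

omit [FiniteDimensional ℝ E] [I.Boundaryless] in
theorem chartMetric_self (x : M) (v w : TangentSpace I x) :
    chartMetric I x (extChartAt I x x) v w = inner ℝ v w := by
  have := chartMetric_continuousLinearMapAt I x (mem_chart_source H x) v w
  rwa [continuousLinearMapAt_self, continuousLinearMapAt_self] at this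

theorem differentiableAt_chartMetric
    [IsContMDiffRiemannianBundle I ∞ E (fun x : M ↦ TangentSpace I x)] (x : M) :
    DifferentiableAt ℝ (chartMetric I x) (extChartAt I x x) := by
  have hsec : ∀ v : E, MDifferentiableAt I (I.prod 𝓘(ℝ, E)) (fun p : M ↦
      (TotalSpace.mk p ((trivializationAt E (TangentSpace I : M → Type _) x).symmL ℝ p v) :
        TotalSpace E (TangentSpace I : M → Type _))) x := fun v ↦ by
    refine ContMDiffAt.mdifferentiableAt (n := 1) ?_ one_ne_zero
    rw [(trivializationAt E (TangentSpace I : M → Type _) x).contMDiffAt_section_iff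
      (FiberBundle.mem_baseSet_trivializationAt' x)]
    refine (contMDiffAt_const (c := v)).congr_of_eventuallyEq ?_
    filter_upwards [(trivializationAt E (TangentSpace I : M → Type _) x).open_baseSet.mem_nhds
      (FiberBundle.mem_baseSet_trivializationAt' x)] with p hp
    have := (trivializationAt E (TangentSpace I : M → Type _) x).continuousLinearMapAt_symmL
      (R := ℝ) hp v
    rwa [Trivialization.continuousLinearMapAt_apply, Trivialization.coe_linearMapAt_of_mem _ hp]
      at this
  have hin : ∀ v w : E, DifferentiableAt ℝ (fun y ↦ chartMetric I x y v w) (extChartAt I x x) :=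
    fun v w ↦ by
      have h := MDifferentiableAt.inner_bundle (IB := I) (F := E)
        (E := fun x : M ↦ TangentSpace I x) (b := fun p : M ↦ p) (hsec v) (hsec w)
      have := ((mdifferentiableAt_iff _ _).1 h).2
      rw [I.range_eq_univ, differentiableWithinAt_univ] at this
      exact this
  exact differentiableAt_clm_of_apply fun v ↦ differentiableAt_clm_of_apply fun w ↦ hin v w

end Chart

/-! ### The Levi-Civita connection in a chart -/

section Chart

variable
  {E : Type*} [NormedAddCommGroup E] [NormedSpace ℝ E] [FiniteDimensional ℝ E]
  {H : Type*} [TopologicalSpace H] (I : ModelWithCorners ℝ E H) [I.Boundaryless]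
  {M : Type*} [TopologicalSpace M] [ChartedSpace H M] [IsManifold I ∞ M]
  [RiemannianBundle (fun x : M ↦ TangentSpace I x)]
  [IsContMDiffRiemannianBundle I ∞ E (fun x : M ↦ TangentSpace I x)]

theorem mvfderiv_inner_coordField (x : M) (v w z : TangentSpace I x) :
    mvfderiv I (fun p : M ↦ inner ℝ (coordField I w p) (coordField I z p)) x v
      = fderiv ℝ (chartMetric I x) (extChartAt I x x) v w z := by
  rw [mvfderiv_eq_fderiv_chart]
  simp only [coordField_eq]
  exact fderiv_bilin_apply (differentiableAt_chartMetric I x) v w z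

theorem christoffelFirst_eq (x : M) (v w z : TangentSpace I x) :
    christoffelFirst I x v w z
      = koszulForm (fderiv ℝ (chartMetric I x) (extChartAt I x x)) v w z := by
  simp only [christoffelFirst, mvfderiv_inner_coordField]
  exact (koszulForm_apply _ _ _ _).symm

theorem inner_christoffel (x : M) (v w z : TangentSpace I x) :
    inner ℝ (christoffel I x v w) z
      = koszulForm (fderiv ℝ (chartMetric I x) (extChartAt I x x)) v w z := by
  let L : TangentSpace I x →ₗ[ℝ] ℝ :=
    (koszulForm (fderiv ℝ (chartMetric I x) (extChartAt I x x)) v w : E →ₗ[ℝ] ℝ)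
  have hL : ∀ z, christoffelFirst I x v w z = L z := christoffelFirst_eq I x v w
  have h : L z = ∑ k, inner ℝ (onb I x k) z * L (onb I x k) := by
    conv_lhs => rw [← (onb I x).sum_repr' z, map_sum]
    simp
  change _ = L z
  rw [h, christoffel, sum_inner]
  refine Finset.sum_congr rfl fun k _ ↦ ?_
  rw [real_inner_smul_left, mul_comm, hL]

/-- The Christoffel symbol `Γ(v, ·)` at `x` in the preferred chart at `x`, as a linear map on the model
space `E`, which is `TangentSpace I x`. -/
noncomputable def christoffelLin (x : M) (v : E) : E →ₗ[ℝ] E where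
  toFun w := christoffel I x v w
  map_add' w w' := by
    refine ext_inner_right ℝ (E := TangentSpace I x) fun z ↦ ?_
    refine Eq.trans ?_ (inner_add_left (𝕜 := ℝ) (E := TangentSpace I x) _ _ z).symm
    refine (inner_christoffel I x v (w + w') z).trans (Eq.trans ?_ (congrArg₂ (· + ·)
      (inner_christoffel I x v w z) (inner_christoffel I x v w' z)).symm)
    exact congrArg (fun T : E →L[ℝ] ℝ ↦ T z) (map_add (koszulForm _ v) w w')
  map_smul' c w := by
    refine ext_inner_right ℝ (E := TangentSpace I x) fun z ↦ ?_
    refine Eq.trans ?_ (real_inner_smul_left (F := TangentSpace I x) _ z c).symm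
    refine (inner_christoffel I x v (c • w) z).trans (Eq.trans ?_ (congrArg (c * ·)
      (inner_christoffel I x v w z)).symm)
    exact congrArg (fun T : E →L[ℝ] ℝ ↦ T z) (map_smul (koszulForm _ v) c w)

theorem isChristoffel_christoffelLin (x : M) :
    IsChristoffel (chartMetric I x) (extChartAt I x x) (christoffelLin I x) := fun v w z ↦
  (chartMetric_self I x _ _).trans
    (inner_christoffel I x v w z)

theorem christoffelLin_symm (x : M) (v w : E) :
    christoffelLin I x v w = christoffelLin I x w v := by
  refine (isChristoffel_christoffelLin I x).symm (differentiableAt_chartMetric I x)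
    (chartMetric_symm I x) (fun v w h ↦ ?_) v w
  exact ext_inner_right ℝ (E := TangentSpace I x) fun z ↦ by
    exact (chartMetric_self I x v z).symm.trans ((h z).trans (chartMetric_self I x w z))

omit [IsContMDiffRiemannianBundle I ∞ E (fun x : M ↦ TangentSpace I x)] in
/-- The extension with constant components has no derivative term at `x`: its covariant derivative
is the Christoffel symbol. -/
theorem leviCivita_coordField (x : M) (v w : TangentSpace I x) :
    leviCivita I (coordField I w) x v = christoffel I x v w := by
  have h0 : mvfderiv I (fun p : M ↦ (trivializationAt E (TangentSpace I : M → Type _)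
      x).continuousLinearMapAt ℝ p (coordField I w p)) x v = 0 := by
    rw [mvfderiv_eq_fderiv_chart]
    have : (fun y ↦ (trivializationAt E (TangentSpace I : M → Type _) x).continuousLinearMapAt ℝ
        ((extChartAt I x).symm y) (coordField I w ((extChartAt I x).symm y)))
        =ᶠ[𝓝 (extChartAt I x x)] fun _ ↦ (w : E) := by
      filter_upwards [extChartAt_target_mem_nhds (I := I) x] with y hy
      rw [coordField_eq]
      refine Trivialization.continuousLinearMapAt_symmL _ ?_ _
      simpa using (extChartAt I x).map_target hy
    rw [this.fderiv_eq]
    exact congrArg (fun T : E →L[ℝ] E ↦ T v) (fderiv_const_apply _)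
  have h1 : mfderiv I I (fun p : M ↦ p) x v = v := by
    have : mfderiv I I (fun p : M ↦ p) x = ContinuousLinearMap.id ℝ _ := mfderiv_id
    rw [this]; rfl
  have h2 : coordField I w x = w := by
    rw [coordField_eq]; exact symmL_self I x w
  rw [leviCivita, covDerivAlong, h0, h1, h2, map_zero, zero_add]

end Chart

/-! ### Maps in charts -/

section Maps

variable
  {E : Type*} [NormedAddCommGroup E] [NormedSpace ℝ E] [FiniteDimensional ℝ E]
  {H : Type*} [TopologicalSpace H] (I : ModelWithCorners ℝ E H) [I.Boundaryless]
  {M : Type*} [TopologicalSpace M] [ChartedSpace H M] [IsManifold I ∞ M]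
  {E' : Type*} [NormedAddCommGroup E'] [NormedSpace ℝ E'] [FiniteDimensional ℝ E']
  {H' : Type*} [TopologicalSpace H'] (I' : ModelWithCorners ℝ E' H') [I'.Boundaryless]
  {N : Type*} [TopologicalSpace N] [ChartedSpace H' N] [IsManifold I' ∞ N]

/-- The expression of `u` in the preferred charts at `x` and `u x`. -/
noncomputable def chartMap (u : M → N) (x : M) (y : E) : E' :=
  extChartAt I' (u x) (u ((extChartAt I x).symm y))

omit [FiniteDimensional ℝ E] [IsManifold I ∞ M] [FiniteDimensional ℝ E'] [I'.Boundaryless]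
  [IsManifold I' ∞ N] in
theorem contDiffAt_chartMap {u : M → N} (hu : ContMDiff I I' ∞ u) (x : M) :
    ContDiffAt ℝ ∞ (chartMap I I' u x) (extChartAt I x x) := by
  have := (contMDiffAt_iff.1 (hu x)).2
  rw [I.range_eq_univ, contDiffWithinAt_univ] at this
  exact this

omit [FiniteDimensional ℝ E] [IsManifold I ∞ M] [FiniteDimensional ℝ E'] [I'.Boundaryless]
  [IsManifold I' ∞ N] in
theorem eventually_mem_chart {u : M → N} (hu : Continuous u) (x : M) :
    ∀ᶠ y in 𝓝 (extChartAt I x x), y ∈ (extChartAt I x).target ∧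
      u ((extChartAt I x).symm y) ∈ (chartAt H' (u x)).source := by
  refine Filter.Eventually.and (extChartAt_target_mem_nhds (I := I) x) ?_
  have hc : ContinuousAt (fun y ↦ u ((extChartAt I x).symm y)) (extChartAt I x x) :=
    hu.continuousAt.comp (continuousAt_extChartAt_symm x)
  apply hc.preimage_mem_nhds
  rw [(extChartAt I x).left_inv (mem_extChartAt_source x)]
  exact chart_source_mem_nhds H' (u x)

omit [FiniteDimensional ℝ E] [FiniteDimensional ℝ E'] [I'.Boundaryless] in
/-- The differential of `u`, read in the trivializations at `x` and `u x`, is the derivative of the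
chart expression of `u`, at all points near `x`. -/
theorem continuousLinearMapAt_mfderiv_symmL {u : M → N} (hu : ContMDiff I I' ∞ u) (x : M) {y : E}
    (hy : y ∈ (extChartAt I x).target)
    (hy' : u ((extChartAt I x).symm y) ∈ (chartAt H' (u x)).source) (v : E) :
    (trivializationAt E' (TangentSpace I' : N → Type _) (u x)).continuousLinearMapAt ℝ
        (u ((extChartAt I x).symm y)) (mfderiv I I' u ((extChartAt I x).symm y)
          ((trivializationAt E (TangentSpace I : M → Type _) x).symmL ℝ
            ((extChartAt I x).symm y) v))
      = fderiv ℝ (chartMap I I' u x) y v := by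
  have hp : (extChartAt I x).symm y ∈ (chartAt H x).source := by
    simpa using (extChartAt I x).map_target hy
  have h1 : HasMFDerivAt 𝓘(ℝ, E) I (extChartAt I x).symm y
      ((trivializationAt E (TangentSpace I : M → Type _) x).symmL ℝ
            ((extChartAt I x).symm y)) := by
    -- The base point is replaced by a variable `z`, since it occurs in the type of the derivative,
    -- which forbids rewriting.
    have aux : ∀ z, z = y → HasMFDerivAt 𝓘(ℝ, E) I (extChartAt I x).symm y
        (mfderivWithin 𝓘(ℝ, E) I (extChartAt I x).symm (Set.range I) z) := by
      rintro z rfl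
      have := (mdifferentiableWithinAt_extChartAt_symm (I := I) hy).hasMFDerivWithinAt
      rw [I.range_eq_univ] at this ⊢
      exact hasMFDerivWithinAt_univ.1 this
    have := aux _ ((extChartAt I x).right_inv hy)
    rw [TangentBundle.symmL_trivializationAt hp]
    exact this
  have h2 : HasMFDerivAt I I' u ((extChartAt I x).symm y) _ :=
    ((hu _).mdifferentiableAt (by simp)).hasMFDerivAt
  have h3 : HasMFDerivAt I' 𝓘(ℝ, E') (extChartAt I' (u x)) (u ((extChartAt I x).symm y))
      ((trivializationAt E' (TangentSpace I' : N → Type _) (u x)).continuousLinearMapAt ℝ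
        (u ((extChartAt I x).symm y))) := by
    rw [TangentBundle.continuousLinearMapAt_trivializationAt hy']
    exact (mdifferentiableAt_extChartAt hy').hasMFDerivAt
  have h4 : HasMFDerivAt 𝓘(ℝ, E) 𝓘(ℝ, E') (chartMap I I' u x) y _ := h3.comp y (h2.comp y h1)
  have h5 := mfderiv_eq_fderiv.symm.trans h4.mfderiv
  exact (congrArg (fun T : E →L[ℝ] E' ↦ T v) h5).symm

omit [FiniteDimensional ℝ E] [FiniteDimensional ℝ E'] [I'.Boundaryless] in
theorem mfderiv_eq_fderiv_chartMap {u : M → N} (hu : ContMDiff I I' ∞ u) (x : M)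
    (v : TangentSpace I x) :
    mfderiv I I' u x v = fderiv ℝ (chartMap I I' u x) (extChartAt I x x) v := by
  have h := continuousLinearMapAt_mfderiv_symmL I I' hu x (mem_extChartAt_target (I := I) x)
    (by rw [extChartAt_to_inv]; exact mem_chart_source H' (u x)) v
  have aux : ∀ p, p = x → (trivializationAt E' (TangentSpace I' : N → Type _)
      (u x)).continuousLinearMapAt ℝ (u p) (mfderiv I I' u p
        ((trivializationAt E (TangentSpace I : M → Type _) x).symmL ℝ p v))
        = mfderiv I I' u x v := by
    rintro p rfl
    rw [continuousLinearMapAt_self]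
    congr 1
    exact symmL_self I p v
  exact (aux _ (extChartAt_to_inv x)).symm.trans h

end Maps

/-! ### The pullback metric and the stress-energy tensor in a chart -/

theorem differentiableAt_clm_inverse {D E G : Type*} [NormedAddCommGroup D] [NormedSpace ℝ D]
    [NormedAddCommGroup E] [NormedSpace ℝ E] [CompleteSpace E]
    [NormedAddCommGroup G] [NormedSpace ℝ G] {f : D → E →L[ℝ] G} {a : D}
    (hf : DifferentiableAt ℝ f a) (e : E ≃L[ℝ] G) (he : (e : E →L[ℝ] G) = f a) :
    DifferentiableAt ℝ (fun y ↦ (f y).inverse) a := by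
  have hi := (contDiffAt_map_inverse (𝕜 := ℝ) (n := 1) e).differentiableAt (by norm_num)
  rw [he] at hi
  exact hi.comp a hf

section Chart

variable
  {E : Type*} [NormedAddCommGroup E] [NormedSpace ℝ E] [FiniteDimensional ℝ E]
  {H : Type*} [TopologicalSpace H] (I : ModelWithCorners ℝ E H)
  {M : Type*} [TopologicalSpace M] [ChartedSpace H M] [IsManifold I ∞ M]
  [RiemannianBundle (fun x : M ↦ TangentSpace I x)]

theorem exists_equiv_chartMetric (x : M) {y : E} (hy : y ∈ (extChartAt I x).target) :
    ∃ e : E ≃L[ℝ] (E →L[ℝ] ℝ), (e : E →L[ℝ] E →L[ℝ] ℝ) = chartMetric I x y := by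
  have hb : (extChartAt I x).symm y ∈
      (trivializationAt E (TangentSpace I : M → Type _) x).baseSet := by
    simpa using (extChartAt I x).map_target hy
  have hinj : Function.Injective (chartMetric I x y : E →ₗ[ℝ] E →L[ℝ] ℝ) := by
    rw [← LinearMap.ker_eq_bot, LinearMap.ker_eq_bot']
    intro v hv
    have h0 : chartMetric I x y v v = 0 := congrArg (fun T : E →L[ℝ] ℝ ↦ T v) hv
    rw [chartMetric_apply, inner_self_eq_zero] at h0
    rw [← Trivialization.continuousLinearMapAt_symmL (R := ℝ) _ hb v, h0, map_zero]
  have hdim : Module.finrank ℝ E = Module.finrank ℝ (E →L[ℝ] ℝ) := by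
    rw [← (LinearMap.toContinuousLinearMap (𝕜 := ℝ) (E := E) (F' := ℝ)).finrank_eq]
    exact Subspace.dual_finrank_eq.symm
  refine ⟨(LinearEquiv.ofInjectiveOfFinrankEq _ hinj hdim).toContinuousLinearEquiv, ?_⟩
  ext v w
  rfl

/-- The coordinates, in the chart at `x`, of the chosen orthonormal basis at a nearby point. -/
theorem exists_basis_onb (x : M) {y : E} (hy : y ∈ (extChartAt I x).target) :
    ∃ b : Module.Basis
        (Fin (Module.finrank ℝ (TangentSpace I ((extChartAt I x).symm y)))) ℝ E,
      (∀ i, (trivializationAt E (TangentSpace I : M → Type _) x).symmL ℝ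
        ((extChartAt I x).symm y) (b i) = onb I ((extChartAt I x).symm y) i) ∧
      ∀ v i, b.repr v i = chartMetric I x y v (b i) := by
  have hb : (extChartAt I x).symm y ∈
      (trivializationAt E (TangentSpace I : M → Type _) x).baseSet := by
    simpa using (extChartAt I x).map_target hy
  let L := (trivializationAt E (TangentSpace I : M → Type _) x).continuousLinearEquivAt ℝ _ hb
  have hL : ∀ v, L.symm v = (trivializationAt E (TangentSpace I : M → Type _) x).symmL ℝ
        ((extChartAt I x).symm y) v := fun v ↦ by
    rw [Trivialization.symmL_apply _ hb]; rfl
  have hbi : ∀ i, (trivializationAt E (TangentSpace I : M → Type _) x).symmL ℝ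
        ((extChartAt I x).symm y) (L (onb I ((extChartAt I x).symm y) i))
      = onb I ((extChartAt I x).symm y) i := fun i ↦ by
    rw [← hL, L.symm_apply_apply]
  refine ⟨(onb I ((extChartAt I x).symm y)).toBasis.map L.toLinearEquiv, ?_, fun v i ↦ ?_⟩
  · intro i
    rw [Module.Basis.map_apply, OrthonormalBasis.coe_toBasis]
    exact hbi i
  · rw [Module.Basis.map_apply, OrthonormalBasis.coe_toBasis, chartMetric_apply]
    refine Eq.trans ?_ (congrArg _ (hbi i)).symm
    rw [real_inner_comm, ← hL v]
    exact (onb I ((extChartAt I x).symm y)).repr_apply_apply _ _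

theorem exists_basis_onb_self (x : M) :
    ∃ b : Module.Basis (Fin (Module.finrank ℝ (TangentSpace I x))) ℝ E,
      (∀ i, b i = onb I x i) ∧
      ∀ v i, b.repr v i = chartMetric I x (extChartAt I x x) v (b i) := by
  refine ⟨(onb I x).toBasis, fun i ↦ ?_, fun v i ↦ ?_⟩
  · exact congrFun (onb I x).coe_toBasis i
  · have h : (onb I x).toBasis.repr v i = inner ℝ (onb I x i) v :=
      (onb I x).repr_apply_apply v i
    have h' : ∀ v : TangentSpace I x,
        inner ℝ (onb I x i) v = chartMetric I x (extChartAt I x x) v (onb I x i) := fun v ↦ by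
      rw [chartMetric_self, real_inner_comm]
    exact (h.trans (h' v)).trans (congrArg _ (congrFun (onb I x).coe_toBasis i).symm)

end Chart

section Maps

variable
  {E : Type*} [NormedAddCommGroup E] [NormedSpace ℝ E] [FiniteDimensional ℝ E]
  {H : Type*} [TopologicalSpace H] (I : ModelWithCorners ℝ E H)
  {M : Type*} [TopologicalSpace M] [ChartedSpace H M] [IsManifold I ∞ M]
  {E' : Type*} [NormedAddCommGroup E'] [NormedSpace ℝ E'] [FiniteDimensional ℝ E']
  {H' : Type*} [TopologicalSpace H'] (I' : ModelWithCorners ℝ E' H')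
  {N : Type*} [TopologicalSpace N] [ChartedSpace H' N] [IsManifold I' ∞ N]
  [RiemannianBundle (fun x : M ↦ TangentSpace I x)]
  [RiemannianBundle (fun y : N ↦ TangentSpace I' y)]

/-- The endomorphism `P` with `⟨P v, w⟩ = (u*h)(v, w)`, in the chart at `x`. It is written with the
inverse of the metric rather than with orthonormal bases, so that its dependence on the base point
is visibly differentiable; `ContinuousLinearMap.inverse` takes a junk value only outside the target of
the chart. -/
noncomputable def pullbackOp (u : M → N) (x : M) (y : E) : E →L[ℝ] E :=
  (chartMetric I x y).inverse ∘L
    (chartMetric I' (u x) (chartMap I I' u x y)).bilinearComp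
      (fderiv ℝ (chartMap I I' u x) y) (fderiv ℝ (chartMap I I' u x) y)

omit [FiniteDimensional ℝ E'] in
theorem chartMetric_pullbackOp (u : M → N) (x : M) {y : E} (hy : y ∈ (extChartAt I x).target)
    (v w : E) : chartMetric I x y (pullbackOp I I' u x y v) w
      = chartMetric I' (u x) (chartMap I I' u x y)
        (fderiv ℝ (chartMap I I' u x) y v) (fderiv ℝ (chartMap I I' u x) y w) := by
  obtain ⟨e, he⟩ := exists_equiv_chartMetric I x hy
  rw [pullbackOp, ← he, ContinuousLinearMap.inverse_equiv]
  simp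

omit [FiniteDimensional ℝ E] [IsManifold I ∞ M] [FiniteDimensional ℝ E']
  [IsManifold I' ∞ N] [RiemannianBundle (fun x : M ↦ TangentSpace I x)]
  [RiemannianBundle (fun y : N ↦ TangentSpace I' y)] in
theorem chartMap_self (u : M → N) (x : M) :
    chartMap I I' u x (extChartAt I x x) = extChartAt I' (u x) (u x) := by
  rw [chartMap, extChartAt_to_inv]

theorem differentiableAt_pullbackOp [I.Boundaryless] [I'.Boundaryless]
    [IsContMDiffRiemannianBundle I ∞ E (fun x : M ↦ TangentSpace I x)]
    [IsContMDiffRiemannianBundle I' ∞ E' (fun x : N ↦ TangentSpace I' x)]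
    {u : M → N} (hu : ContMDiff I I' ∞ u) (x : M) :
    DifferentiableAt ℝ (pullbackOp I I' u x) (extChartAt I x x) := by
  have hu' := contDiffAt_chartMap I I' hu x
  have hdu : DifferentiableAt ℝ (fderiv ℝ (chartMap I I' u x)) (extChartAt I x x) :=
    (hu'.fderiv_right (m := 1) (by norm_cast)).differentiableAt (by norm_num)
  have hh : DifferentiableAt ℝ (fun y ↦ chartMetric I' (u x) (chartMap I I' u x y))
      (extChartAt I x x) := by
    refine DifferentiableAt.comp (g := chartMetric I' (u x)) _ ?_ (hu'.differentiableAt (by simp))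
    rw [chartMap_self]
    exact differentiableAt_chartMetric I' (u x)
  obtain ⟨e, he⟩ := exists_equiv_chartMetric I x (mem_extChartAt_target (I := I) x)
  have hinv := differentiableAt_clm_inverse (differentiableAt_chartMetric I x) e he
  refine hinv.clm_comp ?_
  refine differentiableAt_clm_of_apply fun v ↦ differentiableAt_clm_of_apply fun w ↦ ?_
  exact (hh.clm_apply (hdu.clm_apply (differentiableAt_const v))).clm_apply
    (hdu.clm_apply (differentiableAt_const w))

/-- `‖u*h‖²` in the chart at `x`, as the trace of the square of `pullbackOp`. -/
noncomputable def chartNormSq (u : M → N) (x : M) (y : E) : ℝ :=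
  LinearMap.trace ℝ E (pullbackOp I I' u x y ∘L pullbackOp I I' u x y : E →L[ℝ] E)

/-- `σ_{F,u}(v)` in the charts at `x` and `u x`, for the field with constant components `v`. -/
noncomputable def chartSigmaF (F : ℝ → ℝ) (u : M → N) (x : M) (y v : E) : E' :=
  derivF F (chartNormSq I I' u x y / 4)
    • fderiv ℝ (chartMap I I' u x) y (pullbackOp I I' u x y v)

section AtPoint

variable [I.Boundaryless] {u : M → N} (hu : ContMDiff I I' ∞ u) (x : M) {y : E}
    (hy : y ∈ (extChartAt I x).target)
    (hy' : u ((extChartAt I x).symm y) ∈ (chartAt H' (u x)).source)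
include hu hy hy'

omit [FiniteDimensional ℝ E'] in
theorem pullbackMetric_symmL (v w : E) :
    pullbackMetric I I' u ((extChartAt I x).symm y)
      ((trivializationAt E (TangentSpace I : M → Type _) x).symmL ℝ ((extChartAt I x).symm y) v)
      ((trivializationAt E (TangentSpace I : M → Type _) x).symmL ℝ ((extChartAt I x).symm y) w)
      = chartMetric I x y (pullbackOp I I' u x y v) w := by
  rw [chartMetric_pullbackOp I I' u x hy, pullbackMetric,
    ← chartMetric_continuousLinearMapAt I' (u x) hy',
    continuousLinearMapAt_mfderiv_symmL I I' hu x hy hy',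
    continuousLinearMapAt_mfderiv_symmL I I' hu x hy hy']
  rfl

omit [FiniteDimensional ℝ E'] in
/-- The value of `‖u*h‖²` computed in any orthonormal basis is a trace, so that it does not depend on
the basis and is differentiable in the base point, although `onb` need not even be continuous. -/
theorem pullbackNormSq_eq_chartNormSq :
    pullbackNormSq I I' u ((extChartAt I x).symm y)
      = chartNormSq I I' u x y := by
  obtain ⟨b, hb, hb'⟩ := exists_basis_onb I x hy
  have hsa : ∀ v w, chartMetric I x y (pullbackOp I I' u x y v) w
      = chartMetric I x y (pullbackOp I I' u x y w) v := fun v w ↦ by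
    rw [chartMetric_pullbackOp I I' u x hy, chartMetric_pullbackOp I I' u x hy,
      chartMetric_symm I' (u x)]
  rw [chartNormSq, trace_eq_sum _ b hb', pullbackNormSq]
  refine Finset.sum_congr rfl fun i _ ↦ ?_
  have h : chartMetric I x y ((pullbackOp I I' u x y ∘L pullbackOp I I' u x y) (b i)) (b i)
      = ∑ j, chartMetric I x y (pullbackOp I I' u x y (b i)) (b j)
        * chartMetric I x y (pullbackOp I I' u x y (b j)) (b i) := by
    conv_lhs => rw [ContinuousLinearMap.comp_apply, ← b.sum_repr (pullbackOp I I' u x y (b i))]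
    simp only [map_sum, map_smul, sum_apply, smul_apply, smul_eq_mul, hb']
  rw [h]
  refine Finset.sum_congr rfl fun j _ ↦ ?_
  rw [← hb, ← hb, pullbackMetric_symmL I I' hu x hy hy', hsa (b j), sq]

omit [FiniteDimensional ℝ E'] in
/-- In the charts, `σ_u = du ∘ P`. -/
theorem continuousLinearMapAt_sigma (v : E) :
    (trivializationAt E' (TangentSpace I' : N → Type _) (u x)).continuousLinearMapAt ℝ
        (u ((extChartAt I x).symm y)) (sigma I I' u ((extChartAt I x).symm y)
          ((trivializationAt E (TangentSpace I : M → Type _) x).symmL ℝ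
            ((extChartAt I x).symm y) v))
      = fderiv ℝ (chartMap I I' u x) y (pullbackOp I I' u x y v) := by
  obtain ⟨b, hb, hb'⟩ := exists_basis_onb I x hy
  rw [sigma, map_sum]
  conv_rhs => rw [← b.sum_repr (pullbackOp I I' u x y v), map_sum]
  refine Finset.sum_congr rfl fun j _ ↦ ?_
  rw [map_smul, map_smul, ← hb, pullbackMetric_symmL I I' hu x hy hy',
    continuousLinearMapAt_mfderiv_symmL I I' hu x hy hy', hb']

omit [FiniteDimensional ℝ E'] in
theorem continuousLinearMapAt_sigmaF (F : ℝ → ℝ) (v : E) :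
    (trivializationAt E' (TangentSpace I' : N → Type _) (u x)).continuousLinearMapAt ℝ
        (u ((extChartAt I x).symm y)) (sigmaF I I' u F ((extChartAt I x).symm y)
          ((trivializationAt E (TangentSpace I : M → Type _) x).symmL ℝ
            ((extChartAt I x).symm y) v))
      = chartSigmaF I I' F u x y v := by
  rw [sigmaF, map_smul, continuousLinearMapAt_sigma I I' hu x hy hy',
    pullbackNormSq_eq_chartNormSq I I' hu x hy hy', chartSigmaF]

omit [FiniteDimensional ℝ E'] in
theorem stressEnergy_symmL (F : ℝ → ℝ) (v w : E) :
    stressEnergy I I' u F ((extChartAt I x).symm y)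
      ((trivializationAt E (TangentSpace I : M → Type _) x).symmL ℝ ((extChartAt I x).symm y) v)
      ((trivializationAt E (TangentSpace I : M → Type _) x).symmL ℝ ((extChartAt I x).symm y) w)
      = F (chartNormSq I I' u x y / 4) * chartMetric I x y v w
        - chartMetric I' (u x) (chartMap I I' u x y) (chartSigmaF I I' F u x y v)
          (fderiv ℝ (chartMap I I' u x) y w) := by
  rw [stressEnergy, chartSigmaF, ← chartMetric_continuousLinearMapAt I' (u x) hy',
    continuousLinearMapAt_mfderiv_symmL I I' hu x hy hy',
    continuousLinearMapAt_sigma I I' hu x hy hy', pullbackNormSq_eq_chartNormSq I I' hu x hy hy',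
    map_smul, smul_apply, smul_eq_mul, chartMetric_apply]
  rfl

end AtPoint

end Maps

/-! ### The divergence identity -/

section Energy

variable {E : Type*} [NormedAddCommGroup E] [NormedSpace ℝ E] {F : ℝ → ℝ} {q : E → ℝ} {a : E}

/-- `F` has a derivative at `0` only from the right, which is enough since `q` takes nonnegative values
near `a`. -/
theorem Admissible.hasFDerivAt_comp (hF : Admissible F) (hq : DifferentiableAt ℝ q a)
    (hq0 : ∀ᶠ y in 𝓝 a, 0 ≤ q y) :
    HasFDerivAt (fun y ↦ F (q y / 4)) (derivF F (q a / 4) • ((1 / 4 : ℝ) • fderiv ℝ q a)) a := by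
  have ha : (0 : ℝ) ≤ q a / 4 := div_nonneg hq0.self_of_nhds (by norm_num)
  have hF' : HasDerivWithinAt F (derivF F (q a / 4)) (Set.Ici 0) (q a / 4) :=
    ((hF.contDiffOn.differentiableOn (by norm_num)) _ ha).hasDerivWithinAt
  have hq4 : HasFDerivAt (fun y ↦ q y / 4) ((1 / 4 : ℝ) • fderiv ℝ q a) a := by
    simpa [div_eq_inv_mul] using hq.hasFDerivAt.const_mul (4⁻¹ : ℝ)
  refine (HasDerivWithinAt.comp_hasFDerivWithinAt (s := {y | 0 ≤ q y}) a hF'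
    hq4.hasFDerivWithinAt fun y (hy : 0 ≤ q y) ↦ ?_).hasFDerivAt hq0
  exact div_nonneg hy (by norm_num)

theorem Admissible.differentiableAt_derivF_comp (hF : Admissible F) (hq : DifferentiableAt ℝ q a)
    (hq0 : ∀ᶠ y in 𝓝 a, 0 ≤ q y) :
    DifferentiableAt ℝ (fun y ↦ derivF F (q y / 4)) a := by
  have ha : (0 : ℝ) ≤ q a / 4 := div_nonneg hq0.self_of_nhds (by norm_num)
  have hF' : DifferentiableWithinAt ℝ (derivF F) (Set.Ici 0) (q a / 4) :=
    ((hF.contDiffOn.derivWithin (m := 1) (uniqueDiffOn_Ici 0) (by norm_num)).differentiableOn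
      (by norm_num)) _ ha
  have hq4 : DifferentiableAt ℝ (fun y ↦ q y / 4) a := by
    simpa [div_eq_inv_mul] using hq.const_mul (4⁻¹ : ℝ)
  refine (DifferentiableWithinAt.comp (g := derivF F) (s := {y | 0 ≤ q y}) a hF'
    hq4.differentiableWithinAt fun y (hy : 0 ≤ q y) ↦ ?_).differentiableAt hq0
  exact div_nonneg hy (by norm_num)

end Energy

section Maps

variable
  {E : Type*} [NormedAddCommGroup E] [NormedSpace ℝ E] [FiniteDimensional ℝ E]
  {H : Type*} [TopologicalSpace H] (I : ModelWithCorners ℝ E H) [I.Boundaryless]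
  {M : Type*} [TopologicalSpace M] [ChartedSpace H M] [IsManifold I ∞ M]
  {E' : Type*} [NormedAddCommGroup E'] [NormedSpace ℝ E'] [FiniteDimensional ℝ E']
  {H' : Type*} [TopologicalSpace H'] (I' : ModelWithCorners ℝ E' H') [I'.Boundaryless]
  {N : Type*} [TopologicalSpace N] [ChartedSpace H' N] [IsManifold I' ∞ N]
  [RiemannianBundle (fun x : M ↦ TangentSpace I x)]
  [RiemannianBundle (fun y : N ↦ TangentSpace I' y)]

variable {u : M → N} (hu : ContMDiff I I' ∞ u)
include hu

omit [FiniteDimensional ℝ E'] [I'.Boundaryless] in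
/-- The value of `σ_{F,u}` at the centre `x` of the chart, where the trivializations are the
identity. -/
theorem sigmaF_eq (F : ℝ → ℝ) (x : M) (v : TangentSpace I x) :
    sigmaF I I' u F x v = chartSigmaF I I' F u x (extChartAt I x x) v := by
  have h := continuousLinearMapAt_sigmaF I I' hu x (mem_extChartAt_target (I := I) x)
    (by rw [extChartAt_to_inv]; exact mem_chart_source H' (u x)) F v
  have aux : ∀ p, p = x → (trivializationAt E' (TangentSpace I' : N → Type _)
      (u x)).continuousLinearMapAt ℝ (u p) (sigmaF I I' u F p
        ((trivializationAt E (TangentSpace I : M → Type _) x).symmL ℝ p v))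
        = sigmaF I I' u F x v := by
    rintro p rfl
    rw [continuousLinearMapAt_self]
    congr 1
    exact symmL_self I p v
  exact (aux _ (extChartAt_to_inv x)).symm.trans h

omit [FiniteDimensional ℝ E'] [I'.Boundaryless] in
/-- The value of the stress-energy tensor at the centre `x` of the chart. -/
theorem stressEnergy_eq (F : ℝ → ℝ) (x : M) (v w : TangentSpace I x) :
    stressEnergy I I' u F x v w
      = F (chartNormSq I I' u x (extChartAt I x x) / 4) * chartMetric I x (extChartAt I x x) v w
        - chartMetric I' (u x) (chartMap I I' u x (extChartAt I x x))
          (chartSigmaF I I' F u x (extChartAt I x x) v)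
          (fderiv ℝ (chartMap I I' u x) (extChartAt I x x) w) := by
  have h := stressEnergy_symmL I I' hu x (mem_extChartAt_target (I := I) x)
    (by rw [extChartAt_to_inv]; exact mem_chart_source H' (u x)) F v w
  have aux : ∀ p, p = x → stressEnergy I I' u F p
        ((trivializationAt E (TangentSpace I : M → Type _) x).symmL ℝ p v)
        ((trivializationAt E (TangentSpace I : M → Type _) x).symmL ℝ p w)
        = stressEnergy I I' u F x v w := by
    rintro p rfl
    congr 1
    · exact symmL_self I p v
    · exact symmL_self I p w
  exact (aux _ (extChartAt_to_inv x)).symm.trans h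

variable [IsContMDiffRiemannianBundle I ∞ E (fun x : M ↦ TangentSpace I x)]
    [IsContMDiffRiemannianBundle I' ∞ E' (fun x : N ↦ TangentSpace I' x)]

theorem divForm_sigmaF_eq (F : ℝ → ℝ) (x : M) :
    divForm I I' u (sigmaF I I' u F) x
      = (∑ k, (fderiv ℝ (fun y ↦ chartSigmaF I I' F u x y (onb I x k)) (extChartAt I x x)
            (onb I x k)
          + christoffelLin I' (u x)
              (fderiv ℝ (chartMap I I' u x) (extChartAt I x x) (onb I x k))
              (chartSigmaF I I' F u x (extChartAt I x x) (onb I x k))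
          - chartSigmaF I I' F u x (extChartAt I x x)
              (christoffelLin I x (onb I x k) (onb I x k))) : E') := by
  rw [divForm]
  refine Finset.sum_congr rfl fun k _ ↦ ?_
  have h1 : mvfderiv I (fun p : M ↦ (trivializationAt E' (TangentSpace I' : N → Type _)
      (u x)).continuousLinearMapAt ℝ (u p) (sigmaF I I' u F p (coordField I (onb I x k) p))) x
        (onb I x k)
      = fderiv ℝ (fun y ↦ chartSigmaF I I' F u x y (onb I x k)) (extChartAt I x x)
        (onb I x k) := by
    rw [mvfderiv_eq_fderiv_chart]
    refine congrArg (fun T : E →L[ℝ] E' ↦ T (onb I x k)) (Filter.EventuallyEq.fderiv_eq ?_)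
    filter_upwards [eventually_mem_chart I hu.continuous x (H' := H')] with y hy
    rw [coordField_eq]
    exact continuousLinearMapAt_sigmaF I I' hu x hy.1 hy.2 F _
  have h2 : coordField I (onb I x k) x = onb I x k := by
    rw [coordField_eq]; exact symmL_self I x _
  rw [covDerivAlong, h1, h2, leviCivita_coordField, sigmaF_eq I I' hu, sigmaF_eq I I' hu,
    mfderiv_eq_fderiv_chartMap I I' hu]
  have h3 := symmL_self I' (u x) (fderiv ℝ (fun y ↦ chartSigmaF I I' F u x y (onb I x k))
    (extChartAt I x x) (onb I x k))
  rw [h3]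
  rfl

omit [FiniteDimensional ℝ E'] [I'.Boundaryless]
  [IsContMDiffRiemannianBundle I' ∞ E' (fun x : N ↦ TangentSpace I' x)] in
theorem divTensor_stressEnergy_eq (F : ℝ → ℝ) (x : M) (X : TangentSpace I x) :
    divTensor I (stressEnergy I I' u F) x X
      = ∑ k, (fderiv ℝ (fun y ↦ F (chartNormSq I I' u x y / 4) * chartMetric I x y (onb I x k) X
            - chartMetric I' (u x) (chartMap I I' u x y) (chartSigmaF I I' F u x y (onb I x k))
              (fderiv ℝ (chartMap I I' u x) y X)) (extChartAt I x x) (onb I x k)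
          - (F (chartNormSq I I' u x (extChartAt I x x) / 4) * chartMetric I x (extChartAt I x x)
                (christoffelLin I x (onb I x k) (onb I x k)) X
              - chartMetric I' (u x) (chartMap I I' u x (extChartAt I x x))
                (chartSigmaF I I' F u x (extChartAt I x x)
                  (christoffelLin I x (onb I x k) (onb I x k)))
                (fderiv ℝ (chartMap I I' u x) (extChartAt I x x) X))
          - (F (chartNormSq I I' u x (extChartAt I x x) / 4) * chartMetric I x (extChartAt I x x)
                (onb I x k) (christoffelLin I x (onb I x k) X)
              - chartMetric I' (u x) (chartMap I I' u x (extChartAt I x x))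
                (chartSigmaF I I' F u x (extChartAt I x x) (onb I x k))
                (fderiv ℝ (chartMap I I' u x) (extChartAt I x x)
                  (christoffelLin I x (onb I x k) X)))) := by
  rw [divTensor]
  refine Finset.sum_congr rfl fun k _ ↦ ?_
  rw [mvfderiv_eq_fderiv_chart, leviCivita_coordField, leviCivita_coordField,
    stressEnergy_eq I I' hu, stressEnergy_eq I I' hu]
  have h1 : (fun y ↦ stressEnergy I I' u F ((extChartAt I x).symm y)
        (coordField I (onb I x k) ((extChartAt I x).symm y))
        (coordField I X ((extChartAt I x).symm y)))
      =ᶠ[𝓝 (extChartAt I x x)] fun y ↦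
        F (chartNormSq I I' u x y / 4) * chartMetric I x y (onb I x k) X
            - chartMetric I' (u x) (chartMap I I' u x y) (chartSigmaF I I' F u x y (onb I x k))
              (fderiv ℝ (chartMap I I' u x) y X) := by
    filter_upwards [eventually_mem_chart I hu.continuous x (H' := H')] with y hy
    rw [coordField_eq, coordField_eq]
    exact stressEnergy_symmL I I' hu x hy.1 hy.2 F _ _
  rw [h1.fderiv_eq]
  rfl

theorem divTensor_stressEnergy {F : ℝ → ℝ} (hF : Admissible F) (x : M) (X : TangentSpace I x) :
    divTensor I (stressEnergy I I' u F) x X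
      = -inner ℝ (divForm I I' u (sigmaF I I' u F) x) (mfderiv I I' u x X) := by
  have hu' := contDiffAt_chartMap I I' hu x
  have hev := eventually_mem_chart I hu.continuous x (H' := H')
  obtain ⟨b, hb, hb'⟩ := exists_basis_onb_self I x
  have hP : ∀ᶠ y in 𝓝 (extChartAt I x x), ∀ v w,
      chartMetric I x y (pullbackOp I I' u x y v) w
      = chartMetric I' (u x) (chartMap I I' u x y)
        (fderiv ℝ (chartMap I I' u x) y v) (fderiv ℝ (chartMap I I' u x) y w) := by
    filter_upwards [hev] with y hy v w using chartMetric_pullbackOp I I' u x hy.1 v w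
  have hΓ' := isChristoffel_christoffelLin I' (u x)
  have hh := differentiableAt_chartMetric I' (u x)
  rw [← chartMap_self I I'] at hΓ' hh
  have hPd := differentiableAt_pullbackOp I I' hu x
  have hu2 : ContDiffAt ℝ 2 (chartMap I I' u x) (extChartAt I x x) :=
    hu'.of_le (by norm_cast)
  have hq : DifferentiableAt ℝ (chartNormSq I I' u x) (extChartAt I x x) :=
    (fderiv_trace_sq (isChristoffel_christoffelLin I x) (differentiableAt_chartMetric I x)
      (chartMetric_symm I x) hΓ' hh (chartMetric_symm I' (u x)) hu2 hPd hP b hb' 0).1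
  have hq0 : ∀ᶠ y in 𝓝 (extChartAt I x x), 0 ≤ chartNormSq I I' u x y := by
    filter_upwards [hev] with y hy
    rw [← pullbackNormSq_eq_chartNormSq I I' hu x hy.1 hy.2]
    exact Finset.sum_nonneg fun i _ ↦ Finset.sum_nonneg fun j _ ↦ sq_nonneg _
  have hf := hF.hasFDerivAt_comp hq hq0
  have main := div_stressEnergy_euclidean (isChristoffel_christoffelLin I x)
    (differentiableAt_chartMetric I x) (chartMetric_symm I x) (christoffelLin_symm I x) hΓ' hh
    (chartMetric_symm I' (u x)) (christoffelLin_symm I' (u x)) hu2 hPd hP b hb'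
    hf.differentiableAt (hF.differentiableAt_derivF_comp hq hq0)
    (fun X ↦ by
      rw [hf.fderiv]
      simp only [smul_apply, smul_eq_mul]
      rw [one_div, inv_mul_eq_div]
      rfl) X
  rw [divTensor_stressEnergy_eq I I' hu, divForm_sigmaF_eq I I' hu,
    mfderiv_eq_fderiv_chartMap I I' hu]
  refine Eq.trans ?_ (main.trans (congrArg Neg.neg ?_))
  · simp only [hb]
    rfl
  · simp only [hb]
    rw [chartMap_self]
    exact chartMetric_self I' (u x) _ _

end Maps

end PhiEnergy

theorem proposition2p4 {m n : ℕ}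
    {M : Type*} [TopologicalSpace M] [ChartedSpace (EuclideanSpace ℝ (Fin m)) M]
    [IsManifold (𝓡 m) ∞ M]
    [RiemannianBundle (fun x : M ↦ TangentSpace (𝓡 m) x)]
    [IsContMDiffRiemannianBundle (𝓡 m) ∞ (EuclideanSpace ℝ (Fin m))
      (fun x : M ↦ TangentSpace (𝓡 m) x)]
    {N : Type*} [TopologicalSpace N] [ChartedSpace (EuclideanSpace ℝ (Fin n)) N]
    [IsManifold (𝓡 n) ∞ N]
    [RiemannianBundle (fun y : N ↦ TangentSpace (𝓡 n) y)]
    [IsContMDiffRiemannianBundle (𝓡 n) ∞ (EuclideanSpace ℝ (Fin n))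
      (fun y : N ↦ TangentSpace (𝓡 n) y)]
    (F : ℝ → ℝ) (hF : PhiEnergy.Admissible F)
    (u : M → N) (hu : ContMDiff (𝓡 m) (𝓡 n) ∞ u) :
    (∀ (x : M) (X : TangentSpace (𝓡 m) x),
      PhiEnergy.divTensor (𝓡 m) (PhiEnergy.stressEnergy (𝓡 m) (𝓡 n) u F) x X
        = -inner ℝ (PhiEnergy.divForm (𝓡 m) (𝓡 n) u (PhiEnergy.sigmaF (𝓡 m) (𝓡 n) u F) x)
            (mfderiv (𝓡 m) (𝓡 n) u x X)) ∧
    (PhiEnergy.IsStationary (𝓡 m) (𝓡 n) u F →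
      PhiEnergy.SatisfiesConservationLaw (𝓡 m) (𝓡 n) u F) := by
  have key := PhiEnergy.divTensor_stressEnergy (𝓡 m) (𝓡 n) hu hF
  refine ⟨key, fun hst x X ↦ ?_⟩
  rw [key, hst x, inner_zero_left, neg_zero]
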